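/- For a group $G$, an $SL_2(\mathbb C)$-character of $G$ is a function $\chi:G\to\mathbb C$ of the form $\chi(g)=\operatorname{tr}\rho(g)$ with $\rho:G\to SL_2(\mathbb C)$ a homomorphism. Let $X(G)$ be the set of all $SL_2(\mathbb C)$-characters of $G$ and, for $g\in G$, let $\tau_g:X(G)\to\mathbb C$, $\tau_g(\chi)=\chi(g)$. The $SL_2(\mathbb C)$-character variety of a finitely generated group $G$ is the set $X(G)$ with its structure of an affine algebraic set whose coordinate ring $\mathbb C[X(G)]$ is the $\mathbb C$-algebra of functions on $X(G)$ generated by the functions $\tau_g$, $g\in G$. For $\chi\in X(G)$ let $\mathfrak m_\chi\subset\mathbb C[X(G)]$ be the maximal ideal of functions that vanish at $\chi$, and let $T_\chi X(G)=(\mathfrak m_\chi/\mathfrak m_\chi^2)^*$ be the Zariski tangent space at $\chi$. Let $\chi_0$ be the trivial character, i.e. the trace of the trivial representation ($\chi_0(g)=2$ for all $g$). **Theorem 8.9.** For every integer $n\ge 0$, $$\dim_{\mathbb C} T_{\chi_0}X(\mathbb Z^n)=n+\binom n2=\binom{n+1}2 .$$ -/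

import Mathlib

noncomputable section

/-- The function `g ↦ tr (ρ g)` of a representation `ρ : G → SL₂(ℂ)`. -/
def traceFun {G : Type*} [Group G] (ρ : G →* Matrix.SpecialLinearGroup (Fin 2) ℂ) : G → ℂ :=
  fun g => Matrix.trace (ρ g : Matrix (Fin 2) (Fin 2) ℂ)

/-- The set `X(G)` of all `SL₂(ℂ)`-characters of `G`, i.e. of all traces of representations
`G → SL₂(ℂ)`. -/
def CharacterVariety (G : Type*) [Group G] : Type _ :=
  {χ : G → ℂ // ∃ ρ : G →* Matrix.SpecialLinearGroup (Fin 2) ℂ, χ = traceFun ρ}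

namespace CharacterVariety

variable (G : Type*) [Group G]

/-- The function `τ_g : X(G) → ℂ`, `τ_g χ = χ g`. -/
def tau {G : Type*} [Group G] (g : G) : CharacterVariety G → ℂ := fun χ => χ.1 g

/-- The coordinate ring `ℂ[X(G)]`, as a ring of functions on `X(G)`: the regular functions are the
polynomials in the functions `τ_g`, `g ∈ G`. This is the structure of an affine algebraic set that
`X(G)` carries when `G` is finitely generated (the set `X(G)` is embedded in an affine space by
finitely many of the `τ_g` that generate this ring). It is a reduced ring. -/
def coordinateRing : Subalgebra ℂ (CharacterVariety G → ℂ) :=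
  Algebra.adjoin ℂ (Set.range (tau (G := G)))

variable {G}

/-- Evaluation of regular functions at the point `χ`. -/
def evalAt (χ : CharacterVariety G) : coordinateRing G →ₐ[ℂ] ℂ :=
  (Pi.evalAlgHom ℂ (fun _ : CharacterVariety G => ℂ) χ).comp (coordinateRing G).val

/-- The (maximal) ideal of the regular functions that vanish at the point `χ`. -/
def idealAt (χ : CharacterVariety G) : Ideal (coordinateRing G) :=
  RingHom.ker (evalAt χ)

/-- The Zariski tangent space `T_χ X(G) = (𝔪 / 𝔪²)*`, where `𝔪` is the maximal ideal of the
coordinate ring at `χ`. -/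
abbrev TangentSpace (χ : CharacterVariety G) : Type _ :=
  Module.Dual ℂ (idealAt χ).Cotangent

variable (G)

/-- The trivial character `χ₀`: the trace of the trivial representation. -/
def trivialCharacter : CharacterVariety G :=
  ⟨traceFun 1, 1, rfl⟩

theorem trivialCharacter_apply (g : G) : (trivialCharacter G).1 g = 2 := by
  simp [trivialCharacter, traceFun]

end CharacterVariety

end

noncomputable section

open Matrix Polynomial

/-! ### The parallelogram law on an abelian group -/

/-! Write d(w) for the class of `τ_w - 2` in 𝔪/𝔪². The SL₂ trace identity turns products of `τ`'s
into sums, so the d(w) span 𝔪/𝔪², and modulo 𝔪² it becomes the parallelogram law for d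
(`dtau_parallelogram`). Hence d is a quadratic map on ℤⁿ, and its polar values on pairs of basis
vectors, indexed by `Sym2 (Fin n)`, span: this is the upper bound. For the lower bound, each v in ℤⁿ
gives a curve of characters through χ₀ whose velocity sends d(w) to (v ⬝ w)² (`exists_tangent_sq`).
Polarising in v yields tangent vectors dual, up to nonzero scalars, to the spanning family, which is
therefore a basis. -/

/-- The polar form of a function satisfying the parallelogram law is additive in its first
argument (Jordan–von Neumann). -/
theorem polar_add_left_of_parallelogram {A V : Type*} [AddCommGroup A] [AddCommGroup V]
    [Module ℂ V] {q : A → V} (hq : ∀ x y, q (x + y) + q (x - y) = (2 : ℂ) • q x + (2 : ℂ) • q y)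
    (x y z : A) :
    q (x + y + z) - q (x + y - z) = (q (x + z) - q (x - z)) + (q (y + z) - q (y - z)) := by
  have h0 : q 0 = 0 := by
    have h := hq 0 0
    rw [add_zero, sub_zero] at h
    have h' : (2 : ℂ) • q 0 = 0 := by linear_combination (norm := module) -h
    exact (smul_eq_zero.1 h').resolve_left two_ne_zero
  have hneg : ∀ u, q (-u) = q u := fun u => by
    have h := hq 0 u
    rw [zero_add, zero_sub, h0] at h
    linear_combination (norm := module) h
  -- In h1 - h2 + h3 - h4 the terms q(x ± z - y) cancel because q is even, leaving twice the claim.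
  have h1 := hq (x + z) y
  have h2 := hq (x - z) y
  have h3 := hq (y + z) x
  have h4 := hq (y - z) x
  have e1 := hneg (x + z - y)
  have e2 := hneg (x - z - y)
  rw [show -(x + z - y) = y - z - x by abel] at e1
  rw [show -(x - z - y) = y + z - x by abel] at e2
  rw [show x + z + y = x + y + z by abel] at h1
  rw [show x - z + y = x + y - z by abel] at h2
  rw [show y + z + x = x + y + z by abel, e2] at h3
  rw [show y - z + x = x + y - z by abel, e1] at h4
  linear_combination (norm := module) (1 / 2 : ℂ) • (h1 - h2 + h3 - h4)

/-- The polar form of a function satisfying the parallelogram law. -/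
def polarForm {A V : Type*} [AddCommGroup A] [AddCommGroup V] [Module ℂ V] (q : A → V)
    (hq : ∀ x y, q (x + y) + q (x - y) = (2 : ℂ) • q x + (2 : ℂ) • q y) : A →+ A →+ V :=
  have hneg : ∀ u v, q (u - v) = q (v - u) := fun u v => by
    have h1 := hq u v
    have h2 := hq v u
    rw [add_comm v u] at h2
    linear_combination (norm := module) h1 - h2
  AddMonoidHom.mk' (fun x => AddMonoidHom.mk' (fun y => q (x + y) - q (x - y)) fun y z => by
      have h := polar_add_left_of_parallelogram hq y z x
      rw [hneg (y + z), hneg y, hneg z, add_comm (y + z), add_comm y x, add_comm z x] at h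
      exact h)
    fun x y => by
      ext z
      exact polar_add_left_of_parallelogram hq x y z

section
variable {A V : Type*} [AddCommGroup A] [AddCommGroup V] [Module ℂ V] {q : A → V}
  (hq : ∀ x y, q (x + y) + q (x - y) = (2 : ℂ) • q x + (2 : ℂ) • q y)

theorem polarForm_apply (x y : A) : polarForm q hq x y = q (x + y) - q (x - y) := rfl

theorem polarForm_comm (x y : A) : polarForm q hq x y = polarForm q hq y x := by
  have h1 := hq x y
  have h2 := hq y x
  rw [polarForm_apply, polarForm_apply]
  rw [add_comm y x] at h2 ⊢
  linear_combination (norm := module) h2 - h1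

theorem polarForm_self (x : A) : polarForm q hq x x = (4 : ℂ) • q x := by
  have h0 : q 0 = 0 := by
    have h := hq 0 0
    rw [add_zero, sub_zero] at h
    have h' : (2 : ℂ) • q 0 = 0 := by linear_combination (norm := module) -h
    exact (smul_eq_zero.1 h').resolve_left two_ne_zero
  have h := hq x x
  rw [polarForm_apply]
  rw [sub_self, h0] at h ⊢
  linear_combination (norm := module) h

/-- The values of the polar form on pairs of standard basis vectors of `ℤⁿ`. -/
def polarBasis {n : ℕ} {q : (Fin n → ℤ) → V}
    (hq : ∀ x y, q (x + y) + q (x - y) = (2 : ℂ) • q x + (2 : ℂ) • q y) : Sym2 (Fin n) → V :=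
  Sym2.lift ⟨fun i j => polarForm q hq (Pi.single i 1) (Pi.single j 1),
    fun _ _ => polarForm_comm hq _ _⟩

/-- A function on `ℤⁿ` satisfying the parallelogram law takes its values in the span of the
values of its polar form on pairs of standard basis vectors. -/
theorem mem_span_polarBasis {n : ℕ} {q : (Fin n → ℤ) → V}
    (hq : ∀ x y, q (x + y) + q (x - y) = (2 : ℂ) • q x + (2 : ℂ) • q y) (w : Fin n → ℤ) :
    q w ∈ Submodule.span ℂ (Set.range (polarBasis hq)) := by
  have hw : w = ∑ i, w i • (Pi.single i 1 : Fin n → ℤ) := by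
    ext k
    simp [Finset.sum_apply, Pi.single_apply]
  have h4 : (4 : ℂ) • q w ∈ Submodule.span ℂ (Set.range (polarBasis hq)) := by
    rw [← polarForm_self hq, hw, map_sum]
    refine Submodule.sum_mem _ fun j _ => ?_
    rw [map_sum, AddMonoidHom.finsetSum_apply]
    refine Submodule.sum_mem _ fun i _ => ?_
    rw [map_zsmul, map_zsmul, AddMonoidHom.smul_apply]
    exact zsmul_mem (zsmul_mem (Submodule.subset_span (Set.mem_range_self s(i, j))) _) _
  have h := Submodule.smul_mem _ (4⁻¹ : ℂ) h4
  rwa [smul_smul, inv_mul_cancel₀ (by norm_num), one_smul] at h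

end

/-! ### Linear forms on cotangent spaces -/

theorem exists_comp_eq_of_ker_le {V W U : Type*} [AddCommGroup V] [Module ℂ V] [AddCommGroup W]
    [Module ℂ W] [AddCommGroup U] [Module ℂ U] {f : V →ₗ[ℂ] W} {g : V →ₗ[ℂ] U}
    (hf : Function.Surjective f) (h : LinearMap.ker f ≤ LinearMap.ker g) :
    ∃ φ : W →ₗ[ℂ] U, ∀ x, φ (f x) = g x := by
  obtain ⟨s, hs⟩ := f.exists_rightInverse_of_surjective (LinearMap.range_eq_top.2 hf)
  refine ⟨g ∘ₗ s, fun x => LinearMap.sub_mem_ker_iff.1 (h ?_)⟩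
  exact LinearMap.sub_mem_ker_iff.2 (LinearMap.congr_fun hs (f x))

/-- A linear form satisfying the Leibniz rule at a point `e` induces a linear form on the
cotangent space of an ideal of functions vanishing at `e`. -/
theorem exists_cotangent_dual_of_leibniz {R : Type*} [CommRing R] [Algebra ℂ R] {I : Ideal R}
    {e : R → ℂ} (hI : ∀ f ∈ I, e f = 0) (D : R →ₗ[ℂ] ℂ)
    (hD : ∀ f g, D (f * g) = e f * D g + e g * D f) :
    ∃ φ : Module.Dual ℂ I.Cotangent, ∀ f : I, φ (I.toCotangent f) = D f := by
  let ι : I →ₗ[ℂ] R := (Submodule.subtype I).restrictScalars ℂ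
  have hle : LinearMap.ker (I.toCotangent.restrictScalars ℂ) ≤ LinearMap.ker (D ∘ₗ ι) := by
    intro f hf
    have hf' : (f : R) ∈ I * I := by
      rw [← pow_two]
      exact (Ideal.toCotangent_eq_zero _ f).1 hf
    change D f = 0
    refine Submodule.mul_induction_on hf' (fun a ha b hb => ?_) fun a b ha hb => ?_
    · rw [hD, hI a ha, hI b hb, zero_mul, zero_mul, add_zero]
    · rw [map_add, ha, hb, add_zero]
  obtain ⟨φ, hφ⟩ := exists_comp_eq_of_ker_le (f := I.toCotangent.restrictScalars ℂ)
    I.toCotangent_surjective hle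
  exact ⟨φ, hφ⟩

namespace CharacterVariety

section General
variable {G : Type*} [Group G]

/-! ### Trace identities -/

/-- Cayley–Hamilton in SL₂, B + B⁻¹ = (tr B)·1, multiplied by A and traced. It is used over ℂ and
over ℂ[X]. -/
theorem trace_mul_add_trace_mul_inv {R : Type*} [CommRing R]
    (A B : Matrix.SpecialLinearGroup (Fin 2) R) :
    trace (A * B : Matrix.SpecialLinearGroup (Fin 2) R).1 + trace (A * B⁻¹).1 =
      trace A.1 * trace B.1 := by
  rw [Matrix.SpecialLinearGroup.coe_mul, Matrix.SpecialLinearGroup.coe_mul,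
    Matrix.SpecialLinearGroup.coe_inv]
  simp only [trace_fin_two, adjugate_fin_two, Matrix.mul_apply, Fin.sum_univ_two, of_apply,
    cons_val', cons_val_zero, cons_val_one, cons_val_fin_one]
  ring

theorem tau_mul_tau (g h : G) : tau g * tau h = tau (g * h) + tau (g * h⁻¹) := by
  ext ⟨_, ρ, rfl⟩
  have h := trace_mul_add_trace_mul_inv (ρ g) (ρ h)
  rw [← map_inv, ← map_mul, ← map_mul] at h
  exact h.symm

theorem tau_one : tau (1 : G) = fun _ => 2 := by
  ext ⟨_, ρ, rfl⟩
  simp [tau, traceFun]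

/-- The coordinate ring is spanned by the functions `τ_g` as a vector space. -/
theorem coordinateRing_le_span :
    Subalgebra.toSubmodule (coordinateRing G) ≤ Submodule.span ℂ (Set.range (tau (G := G))) := by
  intro f hf
  change f ∈ Algebra.adjoin ℂ _ at hf
  induction hf using Algebra.adjoin_induction with
  | mem x hx => exact Submodule.subset_span hx
  | algebraMap r =>
    have h : algebraMap ℂ (CharacterVariety G → ℂ) r = (r / 2) • tau (1 : G) := by
      rw [tau_one]
      ext
      simp
    rw [h]
    exact Submodule.smul_mem _ _ (Submodule.subset_span ⟨1, rfl⟩)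
  | add x y _ _ hx hy => exact add_mem hx hy
  | mul x y _ _ hx hy =>
    have h := Submodule.mul_mem_mul hx hy
    rw [Submodule.span_mul_span] at h
    refine Submodule.span_le.2 ?_ h
    rintro _ ⟨_, ⟨g, rfl⟩, _, ⟨k, rfl⟩, rfl⟩
    change tau g * tau k ∈ _
    rw [tau_mul_tau]
    exact add_mem (Submodule.subset_span ⟨_, rfl⟩) (Submodule.subset_span ⟨_, rfl⟩)

/-! ### The cotangent space at the trivial character -/

/-- The function `τ_g` as an element of the coordinate ring. -/
def tauRing (g : G) : coordinateRing G := ⟨tau g, Algebra.subset_adjoin ⟨g, rfl⟩⟩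

theorem evalAt_trivialCharacter_tauRing (g : G) :
    evalAt (trivialCharacter G) (tauRing g) = 2 :=
  trivialCharacter_apply G g

/-- The function `τ_g - 2`, which vanishes at the trivial character. -/
def tauSubTwo (g : G) : idealAt (trivialCharacter G) :=
  ⟨tauRing g - algebraMap ℂ _ 2, by
    rw [idealAt, RingHom.mem_ker, map_sub, evalAt_trivialCharacter_tauRing, AlgHom.commutes]
    exact sub_self _⟩

theorem tauRing_mul_tauRing (g h : G) :
    tauRing g * tauRing h = tauRing (g * h) + tauRing (g * h⁻¹) :=
  Subtype.ext (tau_mul_tau g h)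

/-- The differential of `τ_g` at the trivial character. -/
def dtau (g : G) : (idealAt (trivialCharacter G)).Cotangent :=
  (idealAt (trivialCharacter G)).toCotangent (tauSubTwo g)

/-- The projection `𝔪 → 𝔪 / 𝔪²` as a linear map over `ℂ`. -/
def toCotangentC (χ : CharacterVariety G) : idealAt χ →ₗ[ℂ] (idealAt χ).Cotangent :=
  (idealAt χ).toCotangent.restrictScalars ℂ

/-- By the trace identity, the two sides lift to elements differing by (τ_g - 2)(τ_h - 2), which
lies in 𝔪². -/
theorem dtau_parallelogram (g h : G) :
    dtau (g * h) + dtau (g * h⁻¹) = (2 : ℂ) • dtau g + (2 : ℂ) • dtau h := by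
  change toCotangentC _ (tauSubTwo (g * h)) + toCotangentC _ (tauSubTwo (g * h⁻¹)) =
    (2 : ℂ) • toCotangentC _ (tauSubTwo g) + (2 : ℂ) • toCotangentC _ (tauSubTwo h)
  rw [← map_smul, ← map_smul, ← map_add, ← map_add]
  refine (Ideal.toCotangent_eq _).2 ?_
  have h1 : (((tauSubTwo (g * h) + tauSubTwo (g * h⁻¹) :
      idealAt (trivialCharacter G)) : coordinateRing G) -
      (((2 : ℂ) • tauSubTwo g + (2 : ℂ) • tauSubTwo h : idealAt (trivialCharacter G)) :
        coordinateRing G)) = (tauSubTwo g : coordinateRing G) * tauSubTwo h := by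
    change (tauRing (g * h) - algebraMap ℂ _ 2) + (tauRing (g * h⁻¹) - algebraMap ℂ _ 2) -
      ((2 : ℂ) • (tauRing g - algebraMap ℂ _ 2) + (2 : ℂ) • (tauRing h - algebraMap ℂ _ 2)) =
      (tauRing g - algebraMap ℂ _ 2) * (tauRing h - algebraMap ℂ _ 2)
    simp only [Algebra.smul_def, map_ofNat]
    linear_combination -tauRing_mul_tauRing g h
  rw [h1, pow_two]
  exact Ideal.mul_mem_mul (tauSubTwo g).2 (tauSubTwo h).2

theorem span_dtau : Submodule.span ℂ (Set.range (dtau (G := G))) = ⊤ := by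
  refine eq_top_iff.2 fun x _ => ?_
  obtain ⟨f, rfl⟩ := Ideal.toCotangent_surjective _ x
  obtain ⟨c, hc⟩ := Finsupp.mem_span_range_iff_exists_finsupp.1 (coordinateRing_le_span f.1.2)
  have hc' : (f : coordinateRing G) = c.sum fun g a => a • tauRing g := by
    apply Subtype.ext
    rw [← hc, Finsupp.sum, Finsupp.sum, AddSubmonoidClass.coe_finsetSum]
    rfl
  -- Vanishing at χ₀ makes the coefficients sum to zero, so each τ_g may be replaced by τ_g - 2.
  have h0 : (c.sum fun _ a => a * 2) = 0 := by
    have h : evalAt (trivialCharacter G) (f : coordinateRing G) = 0 := f.2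
    rw [hc', Finsupp.sum, map_sum] at h
    simpa only [map_smul, evalAt_trivialCharacter_tauRing, smul_eq_mul, Finsupp.sum] using h
  have hf : f = c.sum fun g a => a • tauSubTwo g := by
    apply Subtype.ext
    have h1 : ((c.sum fun g a => a • tauSubTwo g : idealAt (trivialCharacter G)) :
        coordinateRing G) = c.sum fun g a => a • (tauRing g - algebraMap ℂ _ 2) := by
      rw [Finsupp.sum, Finsupp.sum, AddSubmonoidClass.coe_finsetSum]
      rfl
    have h2 : (c.sum fun _ a => a • algebraMap ℂ (coordinateRing G) 2) = 0 := by
      simp only [Algebra.smul_def, ← map_mul]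
      rw [Finsupp.sum, ← map_sum]
      exact (congrArg _ h0).trans (map_zero _)
    simp only [smul_sub] at h1
    rw [h1, Finsupp.sum_sub, h2, sub_zero, hc']
  have hx : toCotangentC _ f = c.sum fun g a => a • dtau g := by
    conv_lhs => rw [hf]
    rw [Finsupp.sum, Finsupp.sum, map_sum]
    exact Finset.sum_congr rfl fun g _ => map_smul _ _ _
  change toCotangentC _ f ∈ _
  rw [hx]
  exact Submodule.sum_mem _ fun g _ => Submodule.smul_mem _ _ (Submodule.subset_span ⟨g, rfl⟩)

/-- A linear form on the coordinate ring satisfying the Leibniz rule at `χ` induces a tangent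
vector at `χ`. -/
theorem exists_tangent_of_leibniz {χ : CharacterVariety G} (D : coordinateRing G →ₗ[ℂ] ℂ)
    (hD : ∀ f g, D (f * g) = evalAt χ f * D g + evalAt χ g * D f) :
    ∃ φ : TangentSpace χ, ∀ f : idealAt χ, φ ((idealAt χ).toCotangent f) = D f :=
  exists_cotangent_dual_of_leibniz (e := evalAt χ) (fun _ hf => hf) D hD

end General

/-! ### A curve of characters of `ℤ` -/

/-- The companion matrix of `T² - X T + 1`. -/
def companion : Matrix.SpecialLinearGroup (Fin 2) ℂ[X] :=
  ⟨!![X, -1; 1, 0], by simp [det_fin_two]⟩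

/-- The trace of the `k`-th power of the companion matrix. -/
def tracePoly (k : ℤ) : ℂ[X] := trace (companion ^ k).1

theorem tracePoly_zero : tracePoly 0 = 2 := by
  simp [tracePoly]

theorem tracePoly_one : tracePoly 1 = X := by
  rw [tracePoly, zpow_one]
  simp [companion, trace_fin_two]

theorem tracePoly_rec (k : ℤ) : tracePoly (k + 1) + tracePoly (k - 1) = X * tracePoly k := by
  have h := trace_mul_add_trace_mul_inv (companion ^ k) companion
  rw [← _root_.zpow_add_one, ← _root_.zpow_sub_one] at h
  rw [tracePoly, tracePoly, h, mul_comm, ← tracePoly_one, tracePoly, tracePoly, zpow_one]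

/-- Solution of a linear recurrence with constant second difference. -/
theorem eq_of_second_difference {s : ℤ → ℂ} {c : ℂ}
    (h : ∀ k, s (k + 1) + s (k - 1) = 2 * s k + 2 * c) (k : ℤ) :
    s k = s 0 + k * (s 1 - s 0) + c * (k ^ 2 - k) := by
  -- The recurrence has order two, so two consecutive values are carried through the induction in
  -- both directions.
  suffices H : s k = s 0 + k * (s 1 - s 0) + c * (k ^ 2 - k) ∧
      s (k + 1) = s 0 + (k + 1) * (s 1 - s 0) + c * ((k + 1) ^ 2 - (k + 1)) from H.1
  induction k with
  | zero => simp
  | succ i ih =>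
    have h1 := h (i + 1)
    rw [add_sub_cancel_right] at h1
    push_cast at ih ⊢
    exact ⟨ih.2, by linear_combination h1 - ih.1 + 2 * ih.2⟩
  | pred i ih =>
    have h1 := h (-i)
    push_cast at ih ⊢
    rw [sub_add_cancel]
    exact ⟨by linear_combination h1 - ih.2 + 2 * ih.1, by linear_combination ih.1⟩

theorem tracePoly_eval_two (k : ℤ) : (tracePoly k).eval 2 = 2 := by
  have h := eq_of_second_difference (s := fun k => (tracePoly k).eval 2) (c := 0) (fun k => by
    have h := congrArg (eval 2) (tracePoly_rec k)
    simpa using h) k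
  simpa [tracePoly_zero, tracePoly_one] using h

/-- Differentiating the recurrence at 2 gives constant second difference 2, with initial values 0
and 1. -/
theorem tracePoly_derivative_eval_two (k : ℤ) :
    (derivative (tracePoly k)).eval 2 = (k : ℂ) ^ 2 := by
  have h := eq_of_second_difference (s := fun k => (derivative (tracePoly k)).eval 2) (c := 1)
    (fun k => by
      have h := congrArg (fun p => eval 2 (derivative p)) (tracePoly_rec k)
      simp only [derivative_add, derivative_mul, derivative_X, eval_add, eval_mul, eval_X,
        one_mul, tracePoly_eval_two] at h
      linear_combination h) k
  simp only [tracePoly_zero, tracePoly_one, derivative_X, eval_one, derivative_ofNat,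
    eval_zero] at h
  linear_combination h

/-! ### Tangent vectors to the character variety of `ℤⁿ` -/

section Torus
variable {n : ℕ}

/-- The representation of `ℤⁿ` sending `w` to the `(v ⬝ w)`-th power of the companion matrix at
the parameter `x`. -/
def curveRep (v : Fin n → ℤ) (x : ℂ) :
    Multiplicative (Fin n → ℤ) →* Matrix.SpecialLinearGroup (Fin 2) ℂ where
  toFun w := Matrix.SpecialLinearGroup.map (evalRingHom x) companion ^ (v ⬝ᵥ w.toAdd)
  map_one' := by simp
  map_mul' a b := by rw [toAdd_mul, dotProduct_add, _root_.zpow_add]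

/-- The curve of characters of `ℤⁿ` in the direction `v`. -/
def curve (v : Fin n → ℤ) (x : ℂ) : CharacterVariety (Multiplicative (Fin n → ℤ)) :=
  ⟨traceFun (curveRep v x), _, rfl⟩

theorem curve_apply (v : Fin n → ℤ) (x : ℂ) (w : Multiplicative (Fin n → ℤ)) :
    (curve v x).1 w = (tracePoly (v ⬝ᵥ w.toAdd)).eval x := by
  change trace (Matrix.SpecialLinearGroup.map (evalRingHom x) companion ^ (v ⬝ᵥ w.toAdd)).1 = _
  rw [← map_zpow, tracePoly, trace_fin_two, trace_fin_two, eval_add]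
  rfl

/-- At parameter 2 the companion matrix is unipotent but not the identity: only the character
becomes trivial, not the representation when v ≠ 0. -/
theorem curve_two (v : Fin n → ℤ) : curve v 2 = trivialCharacter _ :=
  Subtype.ext <| funext fun w => by
    rw [curve_apply, tracePoly_eval_two, trivialCharacter_apply]

theorem differentiable_comp_curve (v : Fin n → ℤ)
    (f : coordinateRing (Multiplicative (Fin n → ℤ))) :
    Differentiable ℂ fun x => f.1 (curve v x) := by
  obtain ⟨f, hf⟩ := f
  change f ∈ Algebra.adjoin ℂ _ at hf
  induction hf using Algebra.adjoin_induction with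
  | mem f hf =>
    obtain ⟨w, rfl⟩ := hf
    simp only [tau, curve_apply]
    exact Polynomial.differentiable _
  | algebraMap r => exact differentiable_const r
  | add f g _ _ hf hg => exact hf.add hg
  | mul f g _ _ hf hg => exact hf.mul hg

/-- There is a tangent vector at the trivial character, the velocity of the curve in the
direction `v`, that maps the differential of `τ_w` to `(v ⬝ w)²`. -/
theorem exists_tangent_sq (v : Fin n → ℤ) :
    ∃ φ : TangentSpace (trivialCharacter (Multiplicative (Fin n → ℤ))),
      ∀ w : Fin n → ℤ, φ (dtau (Multiplicative.ofAdd w)) = ((v ⬝ᵥ w : ℤ) : ℂ) ^ 2 := by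
  have hdiff := fun f => (differentiable_comp_curve v f).differentiableAt (x := 2)
  let D : coordinateRing (Multiplicative (Fin n → ℤ)) →ₗ[ℂ] ℂ :=
    { toFun f := deriv (fun x => f.1 (curve v x)) 2
      map_add' f g := deriv_fun_add (hdiff f) (hdiff g)
      map_smul' c f := deriv_const_mul c (hdiff f) }
  obtain ⟨φ, hφ⟩ := exists_tangent_of_leibniz (χ := trivialCharacter _) D fun f g => by
    have h := deriv_fun_mul (hdiff f) (hdiff g)
    rw [curve_two] at h
    refine h.trans ?_
    change D f * evalAt _ g + evalAt _ f * D g = _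
    ring
  refine ⟨φ, fun w => ?_⟩
  rw [dtau, hφ]
  have h1 : (tauSubTwo (Multiplicative.ofAdd w)).1 =
      tauRing (Multiplicative.ofAdd w) - algebraMap ℂ _ 2 := rfl
  have h2 : D (algebraMap ℂ _ 2) = 0 := deriv_const 2 (2 : ℂ)
  rw [h1, map_sub, h2, sub_zero]
  change deriv (fun x => (curve v x).1 (Multiplicative.ofAdd w)) 2 = _
  simp only [curve_apply, toAdd_ofAdd]
  rw [Polynomial.deriv, tracePoly_derivative_eval_two]

/-- The differentials of the `τ_w`, as a function on `ℤⁿ`, satisfy the parallelogram law. -/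
theorem dtau_ofAdd_parallelogram (x y : Fin n → ℤ) :
    dtau (Multiplicative.ofAdd (x + y)) + dtau (Multiplicative.ofAdd (x - y)) =
      (2 : ℂ) • dtau (Multiplicative.ofAdd x) + (2 : ℂ) • dtau (Multiplicative.ofAdd y) := by
  rw [sub_eq_add_neg, ofAdd_add, ofAdd_add, ofAdd_neg, dtau_parallelogram]

/-- The family `B(eᵢ, eⱼ)` in the cotangent space, where `B` is the polar form of the
quadratic map `w ↦ d τ_w`. -/
def cotangentFamily (n : ℕ) :
    Sym2 (Fin n) → (idealAt (trivialCharacter (Multiplicative (Fin n → ℤ)))).Cotangent :=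
  polarBasis (q := fun w => dtau (Multiplicative.ofAdd w)) dtau_ofAdd_parallelogram

theorem span_cotangentFamily (n : ℕ) :
    Submodule.span ℂ (Set.range (cotangentFamily n)) = ⊤ := by
  rw [eq_top_iff, ← span_dtau (G := Multiplicative (Fin n → ℤ)), Submodule.span_le]
  rintro _ ⟨w, rfl⟩
  exact mem_span_polarBasis (dtau_ofAdd_parallelogram (n := n)) w.toAdd

/-- The factor 4 is that of (a + b)² - (a - b)² = 4ab. -/
theorem exists_tangent_cotangentFamily (v : Fin n → ℤ) :
    ∃ φ : TangentSpace (trivialCharacter (Multiplicative (Fin n → ℤ))),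
      ∀ i j, φ (cotangentFamily n s(i, j)) = 4 * v i * v j := by
  obtain ⟨φ, hφ⟩ := exists_tangent_sq v
  refine ⟨φ, fun i j => ?_⟩
  change φ (dtau (Multiplicative.ofAdd (Pi.single i 1 + Pi.single j 1)) -
    dtau (Multiplicative.ofAdd (Pi.single i 1 - Pi.single j 1))) = _
  rw [map_sub, hφ, hφ, dotProduct_add, dotProduct_sub, dotProduct_single_one,
    dotProduct_single_one]
  push_cast
  ring

/-- There is a tangent vector at the trivial character that is nonzero exactly on the member
`B(eₖ, eₗ)` of the spanning family. -/
theorem exists_tangent_dual (k l : Fin n) :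
    ∃ φ : TangentSpace (trivialCharacter (Multiplicative (Fin n → ℤ))),
      φ (cotangentFamily n s(k, l)) ≠ 0 ∧
        ∀ t ≠ s(k, l), φ (cotangentFamily n t) = 0 := by
  -- Polarisation in v: the combination φ₁ - φ₂ - φ₃ extracts the mixed term. Its value at s(k, l)
  -- is 4 if k ≠ l and 8 if k = l.
  obtain ⟨φ₁, h₁⟩ := exists_tangent_cotangentFamily (Pi.single k 1 + Pi.single l 1)
  obtain ⟨φ₂, h₂⟩ := exists_tangent_cotangentFamily (Pi.single k 1 : Fin n → ℤ)
  obtain ⟨φ₃, h₃⟩ := exists_tangent_cotangentFamily (Pi.single l 1 : Fin n → ℤ)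
  have h : ∀ i j, (φ₁ - φ₂ - φ₃) (cotangentFamily n s(i, j)) =
      4 * ((if i = k then 1 else 0) * (if j = l then 1 else 0) +
        (if i = l then 1 else 0) * (if j = k then 1 else 0)) := fun i j => by
    rw [LinearMap.sub_apply, LinearMap.sub_apply, h₁, h₂, h₃]
    simp only [Pi.add_apply, Pi.single_apply]
    push_cast
    ring
  refine ⟨φ₁ - φ₂ - φ₃, ?_, fun t => ?_⟩
  · rw [h]
    by_cases hkl : k = l <;> simp [hkl]
  · induction t with
    | _ i j =>
      intro hne
      rw [h]
      rw [Ne, Sym2.eq_iff] at hne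
      push Not at hne
      have := hne.1
      have := hne.2
      split_ifs <;> simp_all

theorem linearIndependent_cotangentFamily (n : ℕ) :
    LinearIndependent ℂ (cotangentFamily n) := by
  rw [Fintype.linearIndependent_iff]
  intro c hc t
  induction t with
  | _ k l =>
    obtain ⟨φ, h1, h2⟩ := exists_tangent_dual k l
    have h := congrArg φ hc
    rw [map_sum, Finset.sum_eq_single s(k, l), map_smul, map_zero, smul_eq_mul] at h
    · exact (mul_eq_zero.1 h).resolve_right h1
    · intro t _ ht
      rw [map_smul, h2 t ht, smul_zero]
    · exact fun h => absurd (Finset.mem_univ _) h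

theorem rank_tangentSpace_trivialCharacter (n : ℕ) :
    Module.rank ℂ (TangentSpace (trivialCharacter (Multiplicative (Fin n → ℤ)))) =
      ((n + 1).choose 2 : ℕ) := by
  have b := Module.Basis.mk (linearIndependent_cotangentFamily n) (span_cotangentFamily n).ge
  rw [rank_eq_card_basis b.dualBasis, Sym2.card, Fintype.card_fin]

end Torus

end CharacterVariety

end

theorem theorem8p9 (n : ℕ) :
    Module.rank ℂ (CharacterVariety.TangentSpace
        (CharacterVariety.trivialCharacter (Multiplicative (Fin n → ℤ)))) =
      ((n + n.choose 2 : ℕ) : Cardinal) ∧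
    n + n.choose 2 = (n + 1).choose 2 := by
  have h : n + n.choose 2 = (n + 1).choose 2 := by
    rw [Nat.choose_succ_succ' n 1, Nat.choose_one_right]
  exact ⟨by rw [h]; exact CharacterVariety.rank_tangentSpace_trivialCharacter n, h⟩
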